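/- **Locomotion problem.** Fix integers $T,N\ge 0$ ($T$ the last time index, $N$ the number of end-effectors), $m>0$, $\Delta t>0$, vectors $\mathbf g,\mathbf c_{\rm init},\dot{\mathbf c}_{\rm init},\mathbf k_{\rm init}\in\mathbb R^3$ and contact locations $\mathbf r_i^j\in\mathbb R^3$ ($0\le i<T$, $1\le j\le N$). Let $x=(x_0,\dots,x_T)$ with blocks $x_i=(\mathbf f_i^1,\dots,\mathbf f_i^N)\in(\mathbb R^3)^N$ and $z=(\mathbf k'_0,\dots,\mathbf k'_T)\in(\mathbb R^3)^{T+1}$, all spaces carrying the Euclidean norm. Consider $$\min_{x,z}\ f(x)+\sum_{i=0}^T I_i(x_i)+\phi(z)\quad\text{s.t.}\quad \mathbf k'_0=\mathbf k_{\rm init},\qquad \mathbf k'_{i+1}=\sum_{j=1}^N\big(\mathbf r_i^j-\mathbf c_i(\mathbf f)\big)\times\mathbf f_i^j\,\Delta t\quad(0\le i<T),$$ $$\mathbf c_i(\mathbf f)=\mathbf c_{\rm init}+\dot{\mathbf c}_{\rm init}\,i\,\Delta t+\sum_{i'=0}^{i-2}(i-1-i')\Big(\sum_{l=1}^N\frac{\mathbf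 f_{i'}^l}{m}+\mathbf g\Big)(\Delta t)^2$$ (the last sum being empty for $i\le 1$), where $I_i$ is the indicator function ($0$ on $X_i$, $+\infty$ outside) of a closed convex set $X_i\subseteq(\mathbb R^3)^N$. Write the constraints as $A(x)+z=0$; the augmented Lagrangian with penalty $\rho$ is $$L(x,z,w)=f(x)+\sum_{i=0}^T I_i(x_i)+\phi(z)+\langle w,A(x)+z\rangle+\frac{\rho}{2}\|A(x)+z\|^2 .$$ Given $(x^0,z^0,w^0)$, ADMM iterates are sequences satisfying, for all $k\ge 0$, $x_i^{k+1}\in\arg\min_{x_i}L(x^{k+1}_0,\dots,x^{k+1}_{i-1},x_i,x^k_{i+1},\dots,x^k_T,z^k,w^k)$ for $i=0,\dots,T$, then $z^{k+1}\in\arg\min_z L(x^{k+1},z,w^k)$, and $w^{k+1}=w^k+\rho\,(A(x^{k+1})+z^{k+1})$. **Statement.** Let $f$ be $C^2$ and $\mu_f$-strongly convex with $\mu_f>0$, let $\phi$ be $C^2$, $\mu_\phi$-strongly convex with $\mu_\phi>0$ and $L_\phi$-smooth ($\nabla\phi$ is $L_\phi$-Lipschitz, $L_\phi>0$), and let $\rho\ge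 4L_\phi^2/\mu_\phi$. Let $(x^k,z^k,w^k)_{k\ge 0}$ be ADMM iterates with feasible initial blocks, $x_i^0\in X_i$ for all $i$. If $(x^k,z^k,w^k)$ converges to $(x^\star,z^\star,w^\star)$ with $w^\star=0$, then the values $L(x^k,z^k,w^k)$ ($k\ge 0$) and $L(x^\star,z^\star,w^\star)$ are finite and there exists $c_4>1$ such that $$L(x^k,z^k,w^k)-L(x^\star,z^\star,w^\star)\in\mathcal O(c_4^{-k})\qquad(k\to\infty).$$ -/

import Mathlib

open Filter Topology Asymptotics
open scoped Gradient

noncomputable section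

namespace Locomotion

/-- Physical space `ℝ³` with the Euclidean norm. -/
abbrev R3 : Type := EuclideanSpace ℝ (Fin 3)

/-- One block `x_i = (f_i^1, …, f_i^N)`: the contact forces of all `N` end-effectors at a time index. -/
abbrev ForceBlock (N : ℕ) : Type := PiLp 2 (fun _ : Fin N => R3)

/-- The variable `x = (x_0, …, x_T)`, with the Euclidean norm of `ℝ^{3N(T+1)}`. -/
abbrev Forces (T N : ℕ) : Type := PiLp 2 (fun _ : Fin (T + 1) => ForceBlock N)

/-- The variable `z = (k'_0, …, k'_T)` of angular momentum increments, with the Euclidean norm of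
`ℝ^{3(T+1)}`. The multiplier `w` lives in the same space. -/
abbrev Momenta (T : ℕ) : Type := PiLp 2 (fun _ : Fin (T + 1) => R3)

/-- The exterior (cross) product of `ℝ³`. -/
def cross (u v : R3) : R3 :=
  WithLp.toLp 2 (crossProduct (WithLp.ofLp u) (WithLp.ofLp v))

/-- The data of a locomotion problem with time indices `0, …, T` and `N` end-effectors. -/
structure Data (T N : ℕ) where
  /-- mass of the robot -/
  m : ℝ
  m_pos : 0 < m
  /-- time step -/
  dt : ℝ
  dt_pos : 0 < dt
  /-- gravity vector -/
  g : R3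
  /-- initial position of the centre of mass -/
  cInit : R3
  /-- initial velocity of the centre of mass -/
  vInit : R3
  /-- initial angular momentum -/
  kInit : R3
  /-- contact locations `r_i^j` -/
  r : Fin T → Fin N → R3

variable {T N : ℕ}

/-- Position of the centre of mass at time `i` as a function of the forces:
`c_init + i Δt ċ_init + ∑_{i'=0}^{i-2} (i-1-i') (∑_l f_{i'}^l / m + g) Δt²`
(the sum is empty for `i ≤ 1`). -/
def Data.com (P : Data T N) (x : Forces T N) (i : Fin T) : R3 :=
  P.cInit + ((i : ℝ) * P.dt) • P.vInit
    + ∑ i' ∈ Finset.univ.filter (fun i' : Fin (T + 1) => (i' : ℕ) + 2 ≤ (i : ℕ)),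
        (((i : ℝ) - 1 - (i' : ℝ)) * P.dt ^ 2) • ((∑ l : Fin N, P.m⁻¹ • x i' l) + P.g)

/-- The right-hand side of the constraint on `k'_{i+1}`:
`∑_j (r_i^j - c_i(f)) × f_i^j Δt`. -/
def Data.momentumIncrement (P : Data T N) (x : Forces T N) (i : Fin T) : R3 :=
  P.dt • ∑ j : Fin N, cross (P.r i j - P.com x i) (x i.castSucc j)

/-- The map `A` for which the constraints `k'_0 = k_init` and
`k'_{i+1} = ∑_j (r_i^j - c_i(f)) × f_i^j Δt` (`0 ≤ i < T`) read `A(x) + z = 0`. -/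
def Data.A (P : Data T N) (x : Forces T N) : Momenta T :=
  WithLp.toLp 2 (Fin.cases (-P.kInit) (fun i : Fin T => -P.momentumIncrement x i))

open Classical in
/-- The extended-real indicator function of a set: `0` on the set and `+∞` outside. -/
def ind {E : Type*} (S : Set E) (y : E) : EReal := if y ∈ S then 0 else ⊤

/-- The augmented Lagrangian
`f(x) + ∑ I_i(x_i) + φ(z) + ⟨w, A(x) + z⟩ + (ρ/2) ‖A(x) + z‖²`. -/
def Data.lagrangian (P : Data T N) (f : Forces T N → ℝ) (X : Fin (T + 1) → Set (ForceBlock N))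
    (φ : Momenta T → ℝ) (ρ : ℝ) (x : Forces T N) (z w : Momenta T) : EReal :=
  ((f x + φ z + inner ℝ w (P.A x + z) + ρ / 2 * ‖P.A x + z‖ ^ 2 : ℝ) : EReal)
    + ∑ i, ind (X i) (x i)

/-- The point `(x'_0, …, x'_{i-1}, y, x_{i+1}, …, x_T)`. -/
def sweep (x' x : Forces T N) (i : Fin (T + 1)) (y : ForceBlock N) : Forces T N :=
  WithLp.toLp 2 (fun j => if j < i then x' j else if j = i then y else x j)

/-- `(x, z, w)` is a sequence of ADMM iterates: each sweep minimizes the augmented Lagrangian over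
`x_0, …, x_T` one block after the other, then over `z`, and finally updates the multiplier. -/
structure Data.IsADMM (P : Data T N) (f : Forces T N → ℝ) (X : Fin (T + 1) → Set (ForceBlock N))
    (φ : Momenta T → ℝ) (ρ : ℝ) (x : ℕ → Forces T N) (z w : ℕ → Momenta T) : Prop where
  x_step : ∀ k i, IsMinOn
    (fun y => P.lagrangian f X φ ρ (sweep (x (k + 1)) (x k) i y) (z k) (w k)) Set.univ
    (x (k + 1) i)
  z_step : ∀ k, IsMinOn (fun ζ => P.lagrangian f X φ ρ (x (k + 1)) ζ (w k)) Set.univ (z (k + 1))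
  w_step : ∀ k, w (k + 1) = w k + ρ • (P.A (x (k + 1)) + z (k + 1))

end Locomotion

end

/-! The only nonconvexity comes from `A`, and its Taylor remainder enters the Lagrangian paired with
the effective multiplier `w + ρ (A x + z)`. The limit is feasible with `w = 0`, so near it this
multiplier is small, and strong convexity of `f` absorbs the remainder: the smooth Lagrangian
satisfies a strongly convex first-order lower bound there (`exists_smoothLagrangian_strongConvex`).

Two estimates follow. In `decrease`, each block step and the `z` step gain a multiple of their
squared length; the multiplier step costs `‖Δw‖² / ρ`, which the bound on `ρ` makes at most half of
the `z` gain, because `∇ φ (z) = -w` along the iterates. In `gap_le`, the lower bound from the new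
iterate to the limit, together with first-order residuals of the size of the last step, bounds the
gap by a constant times the squared step. Together they contract the gap by a fixed factor
(`exists_isBigO_inv_pow_of_decrease`). -/

/-! ### First-order inequalities and a quadratic Taylor bound -/

section FirstOrder

variable {E F : Type*} [NormedAddCommGroup E] [NormedSpace ℝ E]
  [NormedAddCommGroup F] [NormedSpace ℝ F]

/-- A function of one variable that has a minimum over `[0, 1]` at `0` has a nonnegative derivative
there. -/
theorem HasDerivAt.nonneg_of_forall_le {g : ℝ → ℝ} {g' : ℝ} (hg : HasDerivAt g g' 0)
    (hmin : ∀ t, 0 < t → t ≤ 1 → g 0 ≤ g t) : 0 ≤ g' := by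
  refine ge_of_tendsto hg.tendsto_slope_zero_right ?_
  filter_upwards [Ioc_mem_nhdsGT (zero_lt_one' ℝ)] with t ht
  have := hmin t ht.1 ht.2
  have h1 : 0 ≤ t⁻¹ := inv_nonneg.2 ht.1.le
  simpa using mul_nonneg h1 (sub_nonneg.2 this)

theorem HasFDerivAt.hasDerivAt_line {f : E → F} {f' : E →L[ℝ] F} {x : E} (hf : HasFDerivAt f f' x)
    (v : E) : HasDerivAt (fun t : ℝ => f (x + t • v)) (f' v) 0 := by
  have h1 : HasDerivAt (fun t : ℝ => x + t • v) v 0 := by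
    simpa using ((hasDerivAt_id (0 : ℝ)).smul_const v).const_add x
  have hf' : HasFDerivAt f f' (x + (0 : ℝ) • v) := by simpa using hf
  exact hf'.comp_hasDerivAt (0 : ℝ) h1

/-- The first order characterization of strong convexity. -/
theorem StrongConvexOn.add_fderiv_add_le {f : E → ℝ} {f' : E →L[ℝ] ℝ} {m : ℝ} {x : E}
    (hf : StrongConvexOn Set.univ m f) (hf' : HasFDerivAt f f' x) (y : E) :
    f x + f' (y - x) + m / 2 * ‖y - x‖ ^ 2 ≤ f y := by
  have h1 := (hf'.hasDerivAt_line (y - x)).tendsto_slope_zero_right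
  -- Strong convexity on the segment, divided by `t`, bounds the difference quotient by this
  -- expression; then `t → 0⁺`.
  have h2 : Tendsto (fun t : ℝ => f y - f x - (1 - t) * (m / 2 * ‖y - x‖ ^ 2)) (𝓝[>] 0)
      (𝓝 (f y - f x - (1 - 0) * (m / 2 * ‖y - x‖ ^ 2))) := by
    refine Tendsto.mono_left (Continuous.tendsto ?_ 0) nhdsWithin_le_nhds
    fun_prop
  have h3 := le_of_tendsto_of_tendsto h1 h2 (by
    filter_upwards [Ioc_mem_nhdsGT (zero_lt_one' ℝ)] with t ht
    have h := hf.2 (Set.mem_univ x) (Set.mem_univ y) (sub_nonneg.2 ht.2) ht.1.le (by ring)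
    have e : (1 - t) • x + t • y = x + t • (y - x) := by module
    rw [e, norm_sub_rev x y] at h
    simp only [zero_add, zero_smul, add_zero, smul_eq_mul] at h ⊢
    rw [inv_mul_le_iff₀ ht.1]
    linarith)
  linarith

/-- A `C²` map is locally approximated by its derivative up to a uniform quadratic error. -/
theorem ContDiff.exists_norm_sub_sub_fderiv_le {A : E → F} (hA : ContDiff ℝ 2 A) (x₀ : E) :
    ∃ K ε : ℝ, 0 ≤ K ∧ 0 < ε ∧ ∀ x ∈ Metric.ball x₀ ε, ∀ y ∈ Metric.ball x₀ ε,
      ‖A y - A x - fderiv ℝ A x (y - x)‖ ≤ K * ‖y - x‖ ^ 2 := by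
  have h1 : ContDiff ℝ 1 (fderiv ℝ A) := hA.fderiv_right (by norm_num)
  obtain ⟨K, s, hs, hK⟩ := h1.contDiffAt.exists_lipschitzOnWith (x := x₀)
  obtain ⟨ε, hε, hεs⟩ := Metric.mem_nhds_iff.1 hs
  refine ⟨K, ε, K.2, hε, fun x hx y hy => ?_⟩
  have hseg : segment ℝ x y ⊆ Metric.ball x₀ ε := (convex_ball x₀ ε).segment_subset hx hy
  have := (convex_segment x y).norm_image_sub_le_of_norm_fderiv_le' (𝕜 := ℝ) (f := A)
    (φ := fderiv ℝ A x) (C := K * ‖y - x‖)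
    (fun u _ => hA.differentiable (by norm_num) u) (fun u hu => by
      refine (hK.norm_sub_le (hεs (hseg hu)) (hεs hx)).trans ?_
      gcongr
      exact norm_sub_le_of_mem_segment hu) (left_mem_segment ℝ x y) (right_mem_segment ℝ x y)
  rwa [mul_assoc, ← pow_two] at this

end FirstOrder

/-! ### Geometric decay from a decrease inequality -/

/-- A sequence tending to `0` whose decrease controls its next value decays geometrically. -/
theorem exists_isBigO_inv_pow_of_decrease {V D : ℕ → ℝ} {a C : ℝ} (ha : 0 < a) (hC : 0 < C)
    (hV : Tendsto V atTop (𝓝 0)) (hD : ∀ k, 0 ≤ D k)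
    (hdec : ∀ᶠ k in atTop, V (k + 1) + a * D k ≤ V k)
    (hbd : ∀ᶠ k in atTop, V (k + 1) ≤ C * D k) :
    ∃ c : ℝ, 1 < c ∧ V =O[atTop] (fun k : ℕ => (c ^ k)⁻¹) := by
  obtain ⟨K, hK⟩ := eventually_atTop.1 (hdec.and hbd)
  have hanti : Antitone fun n => V (K + n) := antitone_nat_of_succ_le fun n => by
    have := (hK (K + n) (by omega)).1
    have := mul_nonneg ha.le (hD (K + n))
    rw [← add_assoc]
    linarith
  have hV' : Tendsto (fun n => V (K + n)) atTop (𝓝 0) := by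
    simpa [add_comm] using (tendsto_add_atTop_iff_nat K).2 hV
  have hpos : ∀ n, 0 ≤ V (K + n) := hanti.le_of_tendsto hV'
  -- Eliminating `D k` from the two inequalities gives `(1 + a / C) * V (k + 1) ≤ V k`.
  set c : ℝ := 1 + a / C with hc
  have hac : 0 < a / C := div_pos ha hC
  have hc1 : 1 < c := by linarith
  have hc0 : 0 < c := by linarith
  have hgeo : ∀ n, c ^ n * V (K + n) ≤ V K := by
    intro n
    induction n with
    | zero => simp
    | succ n ih =>
      refine le_trans ?_ ih
      have h1 := hK (K + n) (by omega)
      have h2 : a / C * V (K + n + 1) ≤ a * D (K + n) := by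
        calc a / C * V (K + n + 1) ≤ a / C * (C * D (K + n)) := by gcongr; exact h1.2
          _ = a * D (K + n) := by field_simp
      rw [pow_succ, mul_assoc, ← add_assoc]
      gcongr
      rw [hc]
      linarith [h1.1]
  refine ⟨c, hc1, IsBigO.of_bound (V K * c ^ K) ?_⟩
  filter_upwards [eventually_ge_atTop K] with k hk
  obtain ⟨n, rfl⟩ := Nat.exists_eq_add_of_le hk
  rw [Real.norm_of_nonneg (hpos n), Real.norm_of_nonneg (by positivity), pow_add,
    ← div_eq_mul_inv, le_div_iff₀ (by positivity)]
  calc V (K + n) * (c ^ K * c ^ n) = c ^ K * (c ^ n * V (K + n)) := by ring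
    _ ≤ c ^ K * V K := by gcongr; exact hgeo n
    _ = _ := by ring

/-! ### Local convexity of the smooth Lagrangian -/

namespace Locomotion

noncomputable section Abstract

variable {E Z : Type*} [NormedAddCommGroup E] [NormedSpace ℝ E]
  [NormedAddCommGroup Z] [InnerProductSpace ℝ Z]

/-- The smooth part of the augmented Lagrangian. -/
def smoothLagrangian (f : E → ℝ) (φ : Z → ℝ) (A : E → Z) (ρ : ℝ) (x : E) (z w : Z) : ℝ :=
  f x + φ z + inner ℝ w (A x + z) + ρ / 2 * ‖A x + z‖ ^ 2

/-- The partial derivative of the smooth part of the augmented Lagrangian in `x`, as a function of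
the point `(x, z, w)`. -/
def partialX (f : E → ℝ) (A : E → Z) (ρ : ℝ) (p : E × Z × Z) : E →L[ℝ] ℝ :=
  fderiv ℝ f p.1 + (innerSL ℝ (p.2.2 + ρ • (A p.1 + p.2.1))).comp (fderiv ℝ A p.1)

variable {f : E → ℝ} {φ : Z → ℝ} {A : E → Z}

theorem hasFDerivAt_smoothLagrangian_left (φ : Z → ℝ) (hf : ContDiff ℝ 2 f) (hA : ContDiff ℝ 2 A)
    (ρ : ℝ) (x : E) (z w : Z) :
    HasFDerivAt (fun x => smoothLagrangian f φ A ρ x z w) (partialX f A ρ (x, z, w)) x := by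
  have h1 : HasFDerivAt f (fderiv ℝ f x) x := (hf.differentiable (by norm_num) x).hasFDerivAt
  have h2 : HasFDerivAt (fun x => A x + z) (fderiv ℝ A x) x :=
    (hA.differentiable (by norm_num) x).hasFDerivAt.add_const z
  have h3 := (innerSL ℝ w).hasFDerivAt.comp x h2
  have h4 := ((h1.add_const (φ z)).add h3).add ((h2.norm_sq).const_mul (ρ / 2))
  refine h4.congr_fderiv ?_
  ext v
  simp [partialX]
  ring

theorem exists_norm_partialX_sub_le (hf : ContDiff ℝ 2 f) (hA : ContDiff ℝ 2 A) (ρ : ℝ)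
    (p₀ : E × Z × Z) : ∃ K : ℝ, 0 ≤ K ∧ ∃ s ∈ 𝓝 p₀, ∀ p ∈ s, ∀ q ∈ s,
      ‖partialX f A ρ p - partialX f A ρ q‖ ≤ K * ‖p - q‖ := by
  have h1 : ContDiff ℝ 1 (fderiv ℝ f) := hf.fderiv_right (by norm_num)
  have h2 : ContDiff ℝ 1 (fderiv ℝ A) := hA.fderiv_right (by norm_num)
  have hA1 : ContDiff ℝ 1 A := hA.of_le (by norm_num)
  have h3 : ContDiff ℝ 1 (partialX f A ρ) := by
    unfold partialX
    refine (h1.comp contDiff_fst).add (ContDiff.clm_comp ?_ (h2.comp contDiff_fst))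
    refine (innerSL ℝ).contDiff.comp ?_
    have := hA1.comp (contDiff_fst (𝕜 := ℝ) (E := E) (F := Z × Z))
    simp only [Function.comp_def] at this
    fun_prop
  obtain ⟨K, s, hs, hK⟩ := h3.contDiffAt.exists_lipschitzOnWith (x := p₀)
  exact ⟨K, K.2, s, hs, fun p hp q hq => hK.norm_sub_le hp hq⟩

/-- Near a point where the multiplier `w + ρ (A x + z)` is small, the smooth part of the augmented
Lagrangian is strongly convex in `(x, z)`. -/
theorem exists_smoothLagrangian_strongConvex [CompleteSpace Z] {μf μφ ρ : ℝ} (hf : ContDiff ℝ 2 f)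
    (hμf : 0 < μf) (hfc : StrongConvexOn Set.univ μf f) (hφ : ContDiff ℝ 2 φ)
    (hφc : StrongConvexOn Set.univ μφ φ) (hA : ContDiff ℝ 2 A) (hρ : 0 ≤ ρ) (x₀ : E) :
    ∃ ε : ℝ, 0 < ε ∧ ∀ x ∈ Metric.ball x₀ ε, ∀ x' ∈ Metric.ball x₀ ε, ∀ z z' w : Z,
      ‖w + ρ • (A x + z)‖ ≤ ε →
      smoothLagrangian f φ A ρ x z w + partialX f A ρ (x, z, w) (x' - x)
        + inner ℝ (∇ φ z + (w + ρ • (A x + z))) (z' - z)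
        + μf / 4 * ‖x' - x‖ ^ 2 + μφ / 2 * ‖z' - z‖ ^ 2 ≤ smoothLagrangian f φ A ρ x' z' w := by
  obtain ⟨K, ε, hK, hε, hTaylor⟩ := hA.exists_norm_sub_sub_fderiv_le x₀
  -- At this multiplier size the remainder term costs at most `μf / 4 * ‖x' - x‖ ^ 2`, half of what
  -- `f` provides; `K + 1` guards against `K = 0`.
  have hδ : 0 < μf / (4 * (K + 1)) := by positivity
  refine ⟨min ε (μf / (4 * (K + 1))), lt_min hε hδ, fun x hx x' hx' z z' w hw => ?_⟩
  have hQ := hTaylor x (Metric.ball_subset_ball (min_le_left _ _) hx) x'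
    (Metric.ball_subset_ball (min_le_left _ _) hx')
  have hf1 := hfc.add_fderiv_add_le (hf.differentiable (by norm_num) x).hasFDerivAt x'
  have hφ1 := hφc.add_fderiv_add_le (hφ.differentiable (by norm_num) z).hasFDerivAt z'
  have hg : inner ℝ (∇ φ z) (z' - z) = fderiv ℝ φ z (z' - z) := by simp [gradient]
  set Q := A x' - A x - fderiv ℝ A x (x' - x) with hQdef
  set R := A x + z with hR
  have hR' : A x' + z' = R + (fderiv ℝ A x (x' - x) + (z' - z) + Q) := by rw [hQdef, hR]; abel
  set d := fderiv ℝ A x (x' - x) with hd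
  have hin : -(μf / 4 * ‖x' - x‖ ^ 2) ≤ inner ℝ (w + ρ • R) Q := by
    have h1 := neg_le_of_abs_le (abs_real_inner_le_norm (w + ρ • R) Q)
    have h2 : ‖w + ρ • R‖ * ‖Q‖ ≤ μf / (4 * (K + 1)) * (K * ‖x' - x‖ ^ 2) := by
      gcongr
      exact hw.trans (min_le_right _ _)
    have h3 : μf / (4 * (K + 1)) * (K * ‖x' - x‖ ^ 2) ≤ μf / 4 * ‖x' - x‖ ^ 2 := by
      have : μf / (4 * (K + 1)) * K ≤ μf / 4 := by
        rw [div_mul_eq_mul_div, div_le_div_iff₀ (by positivity) (by norm_num)]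
        nlinarith
      rw [← mul_assoc]
      gcongr
    linarith
  have hpX : partialX f A ρ (x, z, w) (x' - x) = fderiv ℝ f x (x' - x) + inner ℝ (w + ρ • R) d := by
    simp only [partialX, hR, hd, add_apply, ContinuousLinearMap.comp_apply, innerSL_apply_apply]
  -- The second-order part of the penalty is nonnegative and is discarded; its linear part joins `w`
  -- in the effective multiplier.
  have hsq : 0 ≤ ρ / 2 * ‖d + (z' - z) + Q‖ ^ 2 := by positivity
  rw [hpX]
  simp only [smoothLagrangian]
  rw [hR', ← hR, norm_add_sq_real R]
  simp only [inner_add_left, inner_add_right, real_inner_smul_left] at hin hsq ⊢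
  rw [hg]
  linarith

end Abstract

/-- The first order optimality condition for the minimization in `z`. -/
theorem gradient_eq_of_isMinOn {E Z : Type*} [NormedAddCommGroup Z] [InnerProductSpace ℝ Z]
    [CompleteSpace Z] {f : E → ℝ} {φ : Z → ℝ} {A : E → Z} (hφ : ContDiff ℝ 2 φ) {ρ : ℝ} {x : E} {z w : Z}
    (h : IsMinOn (fun ζ => smoothLagrangian f φ A ρ x ζ w) Set.univ z) :
    ∇ φ z = -(w + ρ • (A x + z)) := by
  have h1 : HasFDerivAt φ (fderiv ℝ φ z) z := (hφ.differentiable (by norm_num) z).hasFDerivAt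
  have h2 : HasFDerivAt (fun ζ => A x + ζ) (ContinuousLinearMap.id ℝ Z) z :=
    (hasFDerivAt_id z).const_add (A x)
  have h3 := (innerSL ℝ w).hasFDerivAt.comp z h2
  have h4 := ((h1.const_add (f x)).add h3).add ((h2.norm_sq).const_mul (ρ / 2))
  have h5 := (h.isLocalMin univ_mem).hasFDerivAt_eq_zero h4
  refine ext_inner_right ℝ fun v => ?_
  have h6 := DFunLike.congr_fun h5 v
  simp only [add_apply, ContinuousLinearMap.comp_apply, smul_apply, innerSL_apply_apply,
    ContinuousLinearMap.id_apply, zero_apply, smul_eq_mul] at h6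
  have h7 : inner ℝ (∇ φ z) v = fderiv ℝ φ z v := by simp [gradient]
  rw [h7, inner_neg_left, inner_add_left, real_inner_smul_left]
  simp at h6
  linarith

end Locomotion

/-! ### Smoothness of the constraint map and finiteness of the Lagrangian -/

namespace Locomotion

variable {T N : ℕ}

theorem contDiff_cross {E : Type*} [NormedAddCommGroup E] [NormedSpace ℝ E] {n : WithTop ℕ∞}
    {u v : E → R3} (hu : ContDiff ℝ n u) (hv : ContDiff ℝ n v) :
    ContDiff ℝ n (fun x => cross (u x) (v x)) := by
  have hu' := fun i => contDiff_euclidean.1 hu i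
  have hv' := fun i => contDiff_euclidean.1 hv i
  refine contDiff_euclidean.2 fun i => ?_
  fin_cases i
  · simpa [cross, cross_apply] using ((hu' 1).mul (hv' 2)).sub ((hu' 2).mul (hv' 1))
  · simpa [cross, cross_apply] using ((hu' 2).mul (hv' 0)).sub ((hu' 0).mul (hv' 2))
  · simpa [cross, cross_apply] using ((hu' 0).mul (hv' 1)).sub ((hu' 1).mul (hv' 0))

theorem contDiff_block {n : WithTop ℕ∞} (i : Fin (T + 1)) (j : Fin N) :
    ContDiff ℝ n (fun x : Forces T N => x i j) :=
  contDiff_piLp_apply (𝕜 := ℝ) 2 |>.comp (contDiff_piLp_apply (𝕜 := ℝ) 2)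

theorem Data.contDiff_com (P : Data T N) {n : WithTop ℕ∞} (i : Fin T) :
    ContDiff ℝ n (fun x => P.com x i) := by
  refine contDiff_const.add (ContDiff.sum fun i' _ => ContDiff.const_smul _ ?_)
  exact (ContDiff.sum fun l _ => (contDiff_block i' l).const_smul _).add contDiff_const

theorem Data.contDiff_A (P : Data T N) {n : WithTop ℕ∞} : ContDiff ℝ n P.A := by
  refine (contDiff_piLp 2).2 fun i => ?_
  refine Fin.cases ?_ (fun i => ?_) i
  · exact contDiff_const
  · refine ContDiff.neg (ContDiff.const_smul P.dt (ContDiff.sum fun j _ => ?_))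
    exact contDiff_cross (contDiff_const.sub (P.contDiff_com i)) (contDiff_block _ j)

section Lagrangian

variable (P : Data T N) (f : Forces T N → ℝ) (X : Fin (T + 1) → Set (ForceBlock N))
  (φ : Momenta T → ℝ) (ρ : ℝ)

theorem ind_nonneg {E : Type*} (S : Set E) (y : E) : 0 ≤ ind S y := by
  unfold ind; split_ifs <;> simp

theorem Data.lagrangian_of_feasible {x : Forces T N} (hx : ∀ i, x i ∈ X i) (z w : Momenta T) :
    P.lagrangian f X φ ρ x z w = (smoothLagrangian f φ P.A ρ x z w : ℝ) := by
  have : ∑ i, ind (X i) (x i) = 0 := Finset.sum_eq_zero fun i _ => by simp [ind, hx i]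
  rw [Data.lagrangian, this, add_zero, smoothLagrangian]

variable {P f X φ ρ}

theorem Data.feasible_of_lagrangian_le {x : Forces T N} {z w : Momenta T} {a : ℝ}
    (h : P.lagrangian f X φ ρ x z w ≤ (a : EReal)) (i : Fin (T + 1)) : x i ∈ X i := by
  by_contra hi
  have h1 : (⊤ : EReal) ≤ ∑ i, ind (X i) (x i) := by
    refine le_trans (by simp [ind, hi]) (Finset.single_le_sum (fun i _ => ind_nonneg (X i) (x i))
      (Finset.mem_univ i))
  rw [Data.lagrangian, top_le_iff.1 h1, EReal.coe_add_top] at h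
  exact EReal.coe_ne_top a (top_le_iff.1 h)

end Lagrangian

/-! ### Partially updated points -/

section Sweep

/-- The point whose first `n` blocks are those of `x'` and whose other blocks are those of `x`. -/
def hybrid (x' x : Forces T N) (n : ℕ) : Forces T N :=
  WithLp.toLp 2 (fun j : Fin (T + 1) => if (j : ℕ) < n then x' j else x j)

variable (x' x : Forces T N)

theorem hybrid_zero : hybrid x' x 0 = x := by ext j; simp [hybrid]

theorem hybrid_last : hybrid x' x (T + 1) = x' := PiLp.ext fun j => if_pos j.is_lt

/-- Centring at the updated point, where block `i` is optimal, makes every competitor a one-block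
displacement. -/
theorem sweep_eq_hybrid_add (i : Fin (T + 1)) (y : ForceBlock N) :
    sweep x' x i y = hybrid x' x (i + 1) + PiLp.single 2 i (y - x' i) := by
  refine PiLp.ext fun j => ?_
  rcases lt_trichotomy j i with h | rfl | h
  · have : (j : ℕ) < i + 1 := by omega
    simp only [sweep, hybrid, PiLp.add_apply, if_pos h, if_pos this, PiLp.single_eq_of_ne 2 h.ne,
      add_zero]
  · simp [sweep, hybrid]
  · have : ¬ (j : ℕ) < i + 1 := by omega
    simp only [sweep, hybrid, PiLp.add_apply, if_neg h.not_gt, if_neg h.ne', if_neg this,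
      PiLp.single_eq_of_ne 2 h.ne', add_zero]

theorem sweep_self (i : Fin (T + 1)) : sweep x' x i (x' i) = hybrid x' x (i + 1) := by
  simp [sweep_eq_hybrid_add, ← PiLp.toLp_single]

theorem hybrid_eq_hybrid_succ_add (i : Fin (T + 1)) :
    hybrid x' x i = hybrid x' x (i + 1) + PiLp.single 2 i (x i - x' i) := by
  rw [← sweep_eq_hybrid_add]
  refine PiLp.ext fun j => ?_
  rcases lt_trichotomy j i with h | rfl | h
  · simp [sweep, hybrid, h]
  · simp [sweep, hybrid]
  · simp [sweep, hybrid, h.not_gt, h.ne']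

theorem sum_single (x : Forces T N) : ∑ i, (PiLp.single 2 i (x i) : Forces T N) = x := by
  refine PiLp.ext fun j => ?_
  rw [WithLp.ofLp_sum, Finset.sum_apply]
  simp

theorem norm_sub_hybrid_le (n : ℕ) : ‖x' - hybrid x' x n‖ ≤ ‖x' - x‖ := by
  refine pow_le_pow_iff_left₀ (norm_nonneg _) (norm_nonneg _) two_ne_zero |>.1 ?_
  rw [PiLp.norm_sq_eq_of_L2, PiLp.norm_sq_eq_of_L2]
  refine Finset.sum_le_sum fun j _ => ?_
  by_cases h : (j : ℕ) < n <;> simp [hybrid, h]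

theorem tendsto_hybrid {x : ℕ → Forces T N} {xs : Forces T N} (hx : Tendsto x atTop (𝓝 xs)) (n : ℕ) :
    Tendsto (fun k => hybrid (x (k + 1)) (x k) n) atTop (𝓝 xs) := by
  have h1 := (tendsto_add_atTop_iff_nat 1).2 hx
  have h2 : Tendsto (fun k => ‖x (k + 1) - x k‖) atTop (𝓝 0) := by
    simpa using (h1.sub hx).norm
  have h3 := squeeze_zero_norm (fun k => norm_sub_hybrid_le (x (k + 1)) (x k) n) h2
  simpa using h1.sub h3

end Sweep

/-! ### Feasibility and optimality conditions of the iterates -/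

section Iterates

variable {P : Data T N} {f : Forces T N → ℝ} {X : Fin (T + 1) → Set (ForceBlock N)}
  {φ : Momenta T → ℝ} {ρ : ℝ} {x : ℕ → Forces T N} {z w : ℕ → Momenta T}

/-- Keeping the old block is a competitor of finite value, so the minimizing block has finite value
too. This needs the earlier blocks of the same sweep to be feasible, hence the inner induction. -/
theorem Data.IsADMM.feasible (h : P.IsADMM f X φ ρ x z w) (hx0 : ∀ i, x 0 i ∈ X i) (k : ℕ) :
    ∀ i, x k i ∈ X i := by
  induction k with
  | zero => exact hx0
  | succ k ih =>
    intro i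
    induction i using WellFoundedLT.induction with
    | ind i ihi =>
      have h1 := h.x_step k i (Set.mem_univ (x k i))
      simp only [Set.mem_ofPred_eq] at h1
      rw [P.lagrangian_of_feasible f X φ ρ (x := sweep (x (k + 1)) (x k) i (x k i))] at h1
      · simpa [sweep] using Data.feasible_of_lagrangian_le h1 i
      · intro j
        rcases lt_trichotomy j i with hj | rfl | hj
        · simpa [sweep, hj] using ihi j hj
        · simpa [sweep] using ih j
        · simpa [sweep, hj.not_gt, hj.ne'] using ih j

theorem hybrid_feasible {x' x : Forces T N} (hx' : ∀ i, x' i ∈ X i) (hx : ∀ i, x i ∈ X i) (n : ℕ) :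
    ∀ i, hybrid x' x n i ∈ X i := by
  intro i
  by_cases h : (i : ℕ) < n
  · simpa [hybrid, h] using hx' i
  · simpa [hybrid, h] using hx i

/-- The first order optimality condition for the minimization over one block. -/
theorem Data.IsADMM.partialX_nonneg (h : P.IsADMM f X φ ρ x z w) (hx0 : ∀ i, x 0 i ∈ X i)
    (hf : ContDiff ℝ 2 f) (hX : ∀ i, Convex ℝ (X i)) (k : ℕ) (i : Fin (T + 1)) {y : ForceBlock N}
    (hy : y ∈ X i) :
    0 ≤ partialX f P.A ρ (hybrid (x (k + 1)) (x k) (i + 1), z k, w k)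
      (PiLp.single 2 i (y - x (k + 1) i)) := by
  have hd := (hasFDerivAt_smoothLagrangian_left φ hf P.contDiff_A ρ
    (hybrid (x (k + 1)) (x k) (i + 1)) (z k) (w k)).hasDerivAt_line
      (PiLp.single 2 i (y - x (k + 1) i))
  refine hd.nonneg_of_forall_le fun t ht0 ht1 => ?_
  have hmem := (hX i).add_smul_sub_mem (h.feasible hx0 (k + 1) i) hy ⟨ht0.le, ht1⟩
  have h1 := h.x_step k i (Set.mem_univ (x (k + 1) i + t • (y - x (k + 1) i)))
  simp only [Set.mem_ofPred_eq] at h1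
  have hfeas := hybrid_feasible (h.feasible hx0 (k + 1)) (h.feasible hx0 k) (i + 1)
  have heq : sweep (x (k + 1)) (x k) i (x (k + 1) i + t • (y - x (k + 1) i))
      = hybrid (x (k + 1)) (x k) (i + 1) + t • PiLp.single 2 i (y - x (k + 1) i) := by
    rw [sweep_eq_hybrid_add, add_sub_cancel_left, ← PiLp.toLp_single, ← PiLp.toLp_single,
      Pi.single_smul, WithLp.toLp_smul]
  rw [sweep_self, heq, P.lagrangian_of_feasible f X φ ρ hfeas, P.lagrangian_of_feasible f X φ ρ,
    EReal.coe_le_coe_iff] at h1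
  · simpa using h1
  · intro j
    rw [← heq]
    rcases lt_trichotomy j i with hj | rfl | hj
    · simpa [sweep, hj] using h.feasible hx0 (k + 1) j
    · simpa [sweep] using hmem
    · simpa [sweep, hj.not_gt, hj.ne'] using h.feasible hx0 k j

theorem Data.IsADMM.gradient_eq (h : P.IsADMM f X φ ρ x z w) (hx0 : ∀ i, x 0 i ∈ X i)
    (hφ : ContDiff ℝ 2 φ) (k : ℕ) : ∇ φ (z (k + 1)) = -w (k + 1) := by
  rw [h.w_step k]
  refine gradient_eq_of_isMinOn (f := f) hφ fun ζ _ => ?_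
  have := h.z_step k (Set.mem_univ ζ)
  simpa [P.lagrangian_of_feasible f X φ ρ (h.feasible hx0 (k + 1)), EReal.coe_le_coe_iff] using this

end Iterates

end Locomotion

/-! ### Sufficient decrease and gap estimates -/

namespace Locomotion

variable {T N : ℕ} {P : Data T N} {f : Forces T N → ℝ} {X : Fin (T + 1) → Set (ForceBlock N)}
  {φ : Momenta T → ℝ} {ρ μf μφ Lφ : ℝ} {x : ℕ → Forces T N} {z w : ℕ → Momenta T}

/-- The sweep over the blocks decreases the Lagrangian sufficiently once the iterates are close to
their limit. -/
theorem Data.IsADMM.sweep_decrease (h : P.IsADMM f X φ ρ x z w) (hx0 : ∀ i, x 0 i ∈ X i)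
    (hf : ContDiff ℝ 2 f) (hμf : 0 < μf) (hfc : StrongConvexOn Set.univ μf f)
    (hφ : ContDiff ℝ 2 φ) (hφc : StrongConvexOn Set.univ μφ φ) (hρ : 0 ≤ ρ)
    (hX : ∀ i, Convex ℝ (X i)) {xs : Forces T N} {zs : Momenta T}
    (hx : Tendsto x atTop (𝓝 xs)) (hz : Tendsto z atTop (𝓝 zs)) (hw : Tendsto w atTop (𝓝 0))
    (hA : P.A xs + zs = 0) :
    ∀ᶠ k in atTop, smoothLagrangian f φ P.A ρ (x (k + 1)) (z k) (w k)
      + μf / 4 * ‖x (k + 1) - x k‖ ^ 2 ≤ smoothLagrangian f φ P.A ρ (x k) (z k) (w k) := by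
  obtain ⟨ε, hε, hloc⟩ := exists_smoothLagrangian_strongConvex hf hμf hfc hφ hφc
    (P.contDiff_A (n := 2)) hρ xs
  have hball : ∀ n, ∀ᶠ k in atTop, hybrid (x (k + 1)) (x k) n ∈ Metric.ball xs ε := fun n =>
    tendsto_hybrid hx n (Metric.ball_mem_nhds xs hε)
  have hmul : ∀ n, ∀ᶠ k in atTop,
      ‖w k + ρ • (P.A (hybrid (x (k + 1)) (x k) n) + z k)‖ ≤ ε := fun n => by
    have h1 : Tendsto (fun k => P.A (hybrid (x (k + 1)) (x k) n)) atTop (𝓝 (P.A xs)) :=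
      ((P.contDiff_A (n := 0)).continuous.tendsto xs).comp (tendsto_hybrid hx n)
    have h2 := (hw.add ((h1.add hz).const_smul ρ)).norm
    rw [hA, smul_zero, add_zero, norm_zero] at h2
    exact h2.eventually_le_const hε
  have hall : ∀ᶠ k in atTop, ∀ i : Fin (T + 1),
      hybrid (x (k + 1)) (x k) i ∈ Metric.ball xs ε ∧
      hybrid (x (k + 1)) (x k) (i + 1) ∈ Metric.ball xs ε ∧
      ‖w k + ρ • (P.A (hybrid (x (k + 1)) (x k) (i + 1)) + z k)‖ ≤ ε :=
    eventually_all.2 fun i => (hball i).and ((hball (i + 1)).and (hmul (i + 1)))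
  filter_upwards [hall] with k hk
  set S : ℕ → ℝ := fun n => smoothLagrangian f φ P.A ρ (hybrid (x (k + 1)) (x k) n) (z k) (w k)
    with hS
  have hstep : ∀ i : Fin (T + 1), μf / 4 * ‖x (k + 1) i - x k i‖ ^ 2 ≤ S i - S (i + 1) := by
    intro i
    -- The lower bound is based at the updated point and aimed at the previous one, so that block
    -- optimality makes the linear term nonnegative.
    have h1 := hloc _ (hk i).2.1 _ (hk i).1 (z k) (z k) (w k) (hk i).2.2
    have h2 : hybrid (x (k + 1)) (x k) i - hybrid (x (k + 1)) (x k) (i + 1)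
        = PiLp.single 2 i (x k i - x (k + 1) i) := by
      rw [hybrid_eq_hybrid_succ_add (x (k + 1)) (x k) i, add_sub_cancel_left]
    have h3 := h.partialX_nonneg hx0 hf hX k i (h.feasible hx0 k i)
    rw [h2, PiLp.norm_single, sub_self, inner_zero_right, norm_zero,
      norm_sub_rev (x k i)] at h1
    simp only [hS]
    linarith
  have hsum := Finset.sum_le_sum fun i (_ : i ∈ Finset.univ) => hstep i
  rw [← Finset.mul_sum, Fin.sum_univ_eq_sum_range (fun n => S n - S (n + 1)) (T + 1),
    Finset.sum_range_sub'] at hsum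
  have hnorm : ‖x (k + 1) - x k‖ ^ 2 = ∑ i, ‖x (k + 1) i - x k i‖ ^ 2 := by
    rw [PiLp.norm_sq_eq_of_L2]; rfl
  simp only [hS, hybrid_zero, hybrid_last] at hsum
  rw [hnorm]
  linarith

/-- The multiplier increments are controlled by the increments of `z`. -/
theorem Data.IsADMM.norm_multiplier_sub_le (h : P.IsADMM f X φ ρ x z w) (hx0 : ∀ i, x 0 i ∈ X i)
    (hφ : ContDiff ℝ 2 φ) (hL : ∀ ζ ζ', ‖∇ φ ζ - ∇ φ ζ'‖ ≤ Lφ * ‖ζ - ζ'‖) :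
    ∀ᶠ k in atTop, ‖w (k + 1) - w k‖ ≤ Lφ * ‖z (k + 1) - z k‖ := by
  -- The initial pair `(z 0, w 0)` need not satisfy `∇ φ (z) = -w`.
  filter_upwards [eventually_ge_atTop 1] with k hk
  obtain ⟨n, rfl⟩ := Nat.exists_eq_add_of_le' hk
  have := hL (z (n + 1 + 1)) (z (n + 1))
  rwa [h.gradient_eq hx0 hφ, h.gradient_eq hx0 hφ, neg_sub_neg, norm_sub_rev] at this

/-- One full iteration decreases the Lagrangian sufficiently once the iterates are close to their
limit. -/
theorem Data.IsADMM.decrease (h : P.IsADMM f X φ ρ x z w) (hx0 : ∀ i, x 0 i ∈ X i)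
    (hf : ContDiff ℝ 2 f) (hμf : 0 < μf) (hfc : StrongConvexOn Set.univ μf f)
    (hφ : ContDiff ℝ 2 φ) (hμφ : 0 < μφ) (hφc : StrongConvexOn Set.univ μφ φ) (hLφ : 0 < Lφ)
    (hL : ∀ ζ ζ', ‖∇ φ ζ - ∇ φ ζ'‖ ≤ Lφ * ‖ζ - ζ'‖) (hρ : 4 * Lφ ^ 2 / μφ ≤ ρ)
    (hX : ∀ i, Convex ℝ (X i)) {xs : Forces T N} {zs : Momenta T}
    (hx : Tendsto x atTop (𝓝 xs)) (hz : Tendsto z atTop (𝓝 zs)) (hw : Tendsto w atTop (𝓝 0))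
    (hA : P.A xs + zs = 0) :
    ∀ᶠ k in atTop, smoothLagrangian f φ P.A ρ (x (k + 1)) (z (k + 1)) (w (k + 1))
      + (μf / 4 * ‖x (k + 1) - x k‖ ^ 2 + μφ / 4 * ‖z (k + 1) - z k‖ ^ 2)
        ≤ smoothLagrangian f φ P.A ρ (x k) (z k) (w k) := by
  have hρ0 : 0 < ρ := lt_of_lt_of_le (by positivity) hρ
  obtain ⟨ε, hε, hloc⟩ := exists_smoothLagrangian_strongConvex hf hμf hfc hφ hφc
    (P.contDiff_A (n := 2)) hρ0.le xs
  have hball := ((tendsto_add_atTop_iff_nat 1).2 hx) (Metric.ball_mem_nhds xs hε)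
  have hmul := (((tendsto_add_atTop_iff_nat 1).2 hw).norm).eventually_le_const
    (by simpa using hε)
  filter_upwards [h.sweep_decrease hx0 hf hμf hfc hφ hφc hρ0.le hX hx hz hw hA,
    h.norm_multiplier_sub_le hx0 hφ hL, hball, hmul] with k h1 h2 h3 h4
  -- With the old `w k`, the effective multiplier at the new point is exactly `w (k + 1)`, so the
  -- `z`-gradient vanishes.
  have h5 := hloc _ h3 _ h3 (z (k + 1)) (z k) (w k) (by rwa [← h.w_step k])
  rw [← h.w_step k, h.gradient_eq hx0 hφ, neg_add_cancel, inner_zero_left, sub_self, map_zero,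
    norm_zero, norm_sub_rev (z k)] at h5
  have hdw : w (k + 1) - w k = ρ • (P.A (x (k + 1)) + z (k + 1)) := by
    rw [h.w_step k, add_sub_cancel_left]
  have h6 : smoothLagrangian f φ P.A ρ (x (k + 1)) (z (k + 1)) (w (k + 1))
      = smoothLagrangian f φ P.A ρ (x (k + 1)) (z (k + 1)) (w k)
        + ‖w (k + 1) - w k‖ ^ 2 / ρ := by
    have : ‖w (k + 1) - w k‖ ^ 2 / ρ
        = inner ℝ (w (k + 1) - w k) (P.A (x (k + 1)) + z (k + 1)) := by
      rw [hdw, real_inner_smul_left, real_inner_self_eq_norm_sq, norm_smul, Real.norm_of_nonneg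
        hρ0.le]
      field_simp
    rw [this, inner_sub_left]
    simp only [smoothLagrangian]
    ring
  have h7 : ‖w (k + 1) - w k‖ ^ 2 / ρ ≤ μφ / 4 * ‖z (k + 1) - z k‖ ^ 2 := by
    rw [div_le_iff₀ hρ0]
    calc ‖w (k + 1) - w k‖ ^ 2 ≤ (Lφ * ‖z (k + 1) - z k‖) ^ 2 := by gcongr
      _ = Lφ ^ 2 * ‖z (k + 1) - z k‖ ^ 2 := by ring
      _ ≤ (μφ / 4 * ρ) * ‖z (k + 1) - z k‖ ^ 2 := by
        gcongr
        rw [div_le_iff₀ hμφ] at hρ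
        linarith
      _ = _ := by ring
  linarith

theorem norm_prod_sub_le {E F G : Type*} [SeminormedAddCommGroup E] [SeminormedAddCommGroup F]
    [SeminormedAddCommGroup G] {a a' : E} {b b' : F} {c c' : G} {δ : ℝ} (ha : ‖a - a'‖ ≤ δ)
    (hb : ‖b - b'‖ ≤ δ) (hc : ‖c - c'‖ ≤ δ) : ‖(a, b, c) - (a', b', c')‖ ≤ δ :=
  max_le ha (max_le hb hc)

theorem neg_mul_le_of_norm_sub_le {E : Type*} [SeminormedAddCommGroup E] [NormedSpace ℝ E]
    {g g' : E →L[ℝ] ℝ} {v : E} {c e : ℝ} (hg : ‖g - g'‖ ≤ c) (hv : 0 ≤ g' v) (he : ‖v‖ ≤ e) :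
    -(c * e) ≤ g v := by
  have h1 := neg_le_of_abs_le (((g - g').le_opNorm v).trans
    (mul_le_mul hg he (norm_nonneg _) ((norm_nonneg _).trans hg)))
  rw [sub_apply] at h1
  linarith

/-- Once the iterates are close to their limit, the optimality gap is bounded by the squared size
of the last step. -/
theorem Data.IsADMM.gap_le (h : P.IsADMM f X φ ρ x z w) (hx0 : ∀ i, x 0 i ∈ X i)
    (hf : ContDiff ℝ 2 f) (hμf : 0 < μf) (hfc : StrongConvexOn Set.univ μf f)
    (hφ : ContDiff ℝ 2 φ) (hμφ : 0 < μφ) (hφc : StrongConvexOn Set.univ μφ φ) (hLφ : 0 < Lφ)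
    (hL : ∀ ζ ζ', ‖∇ φ ζ - ∇ φ ζ'‖ ≤ Lφ * ‖ζ - ζ'‖) (hρ : 0 ≤ ρ)
    (hX : ∀ i, Convex ℝ (X i)) {xs : Forces T N} {zs : Momenta T} (hxs : ∀ i, xs i ∈ X i)
    (hx : Tendsto x atTop (𝓝 xs)) (hz : Tendsto z atTop (𝓝 zs)) (hw : Tendsto w atTop (𝓝 0))
    (hA : P.A xs + zs = 0) :
    ∃ C : ℝ, 0 < C ∧ ∀ᶠ k in atTop, smoothLagrangian f φ P.A ρ (x (k + 1)) (z (k + 1)) (w (k + 1))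
      - (f xs + φ zs) ≤ C * (‖x (k + 1) - x k‖ ^ 2 + ‖z (k + 1) - z k‖ ^ 2) := by
  obtain ⟨ε, hε, hloc⟩ := exists_smoothLagrangian_strongConvex hf hμf hfc hφ hφc
    (P.contDiff_A (n := 2)) hρ xs
  obtain ⟨K, hK, s, hs, hLip⟩ := exists_norm_partialX_sub_le hf (P.contDiff_A (n := 2)) ρ
    (xs, zs, (0 : Momenta T))
  have hx1 := (tendsto_add_atTop_iff_nat 1).2 hx
  have hz1 := (tendsto_add_atTop_iff_nat 1).2 hz
  have hw1 := (tendsto_add_atTop_iff_nat 1).2 hw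
  have hball := hx1 (Metric.ball_mem_nhds xs hε)
  have hmul : ∀ᶠ k in atTop, ‖w (k + 1) + ρ • (P.A (x (k + 1)) + z (k + 1))‖ ≤ ε := by
    have h1 := ((P.contDiff_A (n := 0)).continuous.tendsto xs).comp hx1
    have h2 := (hw1.add ((h1.add hz1).const_smul ρ)).norm
    rw [hA, smul_zero, add_zero, norm_zero] at h2
    exact h2.eventually_le_const hε
  have hall : ∀ᶠ k in atTop, ∀ i : Fin (T + 1),
      (hybrid (x (k + 1)) (x k) (i + 1), z k, w k) ∈ s := eventually_all.2 fun i =>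
    ((tendsto_hybrid hx (i + 1)).prodMk_nhds (hz.prodMk_nhds hw)) hs
  have hnew := (hx1.prodMk_nhds (hz1.prodMk_nhds hw1)) hs
  set M : ℝ := (T + 1) * K with hM
  have hM0 : 0 ≤ M := by positivity
  refine ⟨M ^ 2 / μf * (2 * (1 + Lφ) ^ 2) + Lφ ^ 2 / (2 * μφ), by positivity, ?_⟩
  filter_upwards [h.norm_multiplier_sub_le hx0 hφ hL, hball, hmul, hall, hnew]
    with k hdw hb hm hold hn
  have h1 := hloc _ hb xs (Metric.mem_ball_self hε) (z (k + 1)) zs (w (k + 1)) hm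
  -- Feasibility of the limit removes the dependence on the multiplier.
  have hstar : smoothLagrangian f φ P.A ρ xs zs (w (k + 1)) = f xs + φ zs := by
    simp [smoothLagrangian, hA]
  set a := ‖x (k + 1) - x k‖ with ha
  set b := ‖z (k + 1) - z k‖ with hbdef
  set e := ‖xs - x (k + 1)‖ with he
  set e' := ‖zs - z (k + 1)‖ with he'
  have ha0 : 0 ≤ a := norm_nonneg _
  have hb0 : 0 ≤ b := norm_nonneg _
  have he0 : 0 ≤ e := norm_nonneg _
  have hzpart : -(Lφ * b * e') ≤ inner ℝ (∇ φ (z (k + 1))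
      + (w (k + 1) + ρ • (P.A (x (k + 1)) + z (k + 1)))) (zs - z (k + 1)) := by
    have h2 : ∇ φ (z (k + 1)) + (w (k + 1) + ρ • (P.A (x (k + 1)) + z (k + 1)))
        = w (k + 1) - w k := by
      rw [h.gradient_eq hx0 hφ, neg_add_cancel_left, h.w_step k, add_sub_cancel_left]
    rw [h2]
    refine neg_le_of_abs_le ((abs_real_inner_le_norm _ _).trans ?_)
    gcongr
  have hxpart : -(M * (a + (1 + Lφ) * b) * e)
      ≤ partialX f P.A ρ (x (k + 1), z (k + 1), w (k + 1)) (xs - x (k + 1)) := by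
    -- Block optimality holds at the partially updated point with the old `z` and `w`; local
    -- Lipschitz continuity of `partialX` transfers it to the new iterate at a cost proportional to
    -- the step.
    have hblock : ∀ i : Fin (T + 1), -(K * (a + (1 + Lφ) * b) * e)
        ≤ partialX f P.A ρ (x (k + 1), z (k + 1), w (k + 1))
          (PiLp.single 2 i ((xs - x (k + 1)) i)) := by
      intro i
      set v : Forces T N := PiLp.single 2 i ((xs - x (k + 1)) i) with hv
      have h2 : 0 ≤ partialX f P.A ρ (hybrid (x (k + 1)) (x k) (i + 1), z k, w k) v :=
        h.partialX_nonneg hx0 hf hX k i (hxs i)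
      have h3 := hLip _ hn _ (hold i)
      have h4 : ‖(x (k + 1), z (k + 1), w (k + 1))
          - (hybrid (x (k + 1)) (x k) (i + 1), z k, w k)‖ ≤ a + (1 + Lφ) * b := by
        have hLb : 0 ≤ Lφ * b := by positivity
        have := norm_sub_hybrid_le (x (k + 1)) (x k) (i + 1)
        exact norm_prod_sub_le (by linarith) (by linarith) (by linarith)
      have h5 : ‖v‖ ≤ e := by
        rw [hv, PiLp.norm_single]
        exact PiLp.norm_apply_le _ i
      exact neg_mul_le_of_norm_sub_le (h3.trans (mul_le_mul_of_nonneg_left h4 hK)) h2 h5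
    have hsum := Finset.sum_le_sum fun i (_ : i ∈ Finset.univ) => hblock i
    rw [← map_sum, sum_single] at hsum
    simp only [Finset.sum_const, Finset.card_univ, Fintype.card_fin, nsmul_eq_mul] at hsum
    push_cast at hsum
    rw [hM]
    linarith
  -- The Young weights are chosen so that the distances to the limit cancel against the quadratic
  -- terms of `h1`.
  have hyoung : M * (a + (1 + Lφ) * b) * e
      ≤ M ^ 2 / μf * (a + (1 + Lφ) * b) ^ 2 + μf / 4 * e ^ 2 := by
    have h2 : M ^ 2 / μf * (a + (1 + Lφ) * b) ^ 2 + μf / 4 * e ^ 2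
        - M * (a + (1 + Lφ) * b) * e = (M * (a + (1 + Lφ) * b) - μf / 2 * e) ^ 2 / μf := by
      field_simp
      ring
    have h3 : 0 ≤ (M * (a + (1 + Lφ) * b) - μf / 2 * e) ^ 2 / μf := by positivity
    linarith
  have hyoung' : Lφ * b * e' ≤ Lφ ^ 2 / (2 * μφ) * b ^ 2 + μφ / 2 * e' ^ 2 := by
    have h2 : Lφ ^ 2 / (2 * μφ) * b ^ 2 + μφ / 2 * e' ^ 2 - Lφ * b * e'
        = (Lφ * b - μφ * e') ^ 2 / (2 * μφ) := by
      field_simp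
      ring
    have h3 : 0 ≤ (Lφ * b - μφ * e') ^ 2 / (2 * μφ) := by positivity
    linarith
  have hsq : (a + (1 + Lφ) * b) ^ 2 ≤ 2 * (1 + Lφ) ^ 2 * (a ^ 2 + b ^ 2) := by
    have h2 : a ^ 2 ≤ (1 + Lφ) ^ 2 * a ^ 2 :=
      le_mul_of_one_le_left (sq_nonneg a) (one_le_pow₀ (by linarith))
    linarith [sq_nonneg (a - (1 + Lφ) * b)]
  have hC1 : M ^ 2 / μf * (a + (1 + Lφ) * b) ^ 2
      ≤ M ^ 2 / μf * (2 * (1 + Lφ) ^ 2 * (a ^ 2 + b ^ 2)) := by gcongr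
  have hC2 : Lφ ^ 2 / (2 * μφ) * b ^ 2 ≤ Lφ ^ 2 / (2 * μφ) * (a ^ 2 + b ^ 2) := by
    gcongr
    linarith [sq_nonneg a]
  rw [hstar] at h1
  linarith

end Locomotion

/-! ### Conclusion -/

theorem mainTheorem10 {T N : ℕ} (P : Locomotion.Data T N)
    (f : Locomotion.Forces T N → ℝ) (φ : Locomotion.Momenta T → ℝ)
    (X : Fin (T + 1) → Set (Locomotion.ForceBlock N))
    (μf μφ Lφ ρ : ℝ)
    (hf : ContDiff ℝ 2 f) (hμf : 0 < μf) (hfconv : StrongConvexOn Set.univ μf f)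
    (hXconv : ∀ i, Convex ℝ (X i)) (hXclosed : ∀ i, IsClosed (X i))
    (hφ : ContDiff ℝ 2 φ) (hμφ : 0 < μφ) (hφconv : StrongConvexOn Set.univ μφ φ)
    (hLφ : 0 < Lφ) (hφsmooth : ∀ ζ ζ', ‖∇ φ ζ - ∇ φ ζ'‖ ≤ Lφ * ‖ζ - ζ'‖)
    (hρ : 4 * Lφ ^ 2 / μφ ≤ ρ)
    (x : ℕ → Locomotion.Forces T N) (z w : ℕ → Locomotion.Momenta T)
    (hx0 : ∀ i, x 0 i ∈ X i)
    (hADMM : P.IsADMM f X φ ρ x z w)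
    (xs : Locomotion.Forces T N) (zs ws : Locomotion.Momenta T)
    (hx : Tendsto x atTop (𝓝 xs)) (hz : Tendsto z atTop (𝓝 zs)) (hw : Tendsto w atTop (𝓝 ws))
    (hws : ws = 0) :
    ∃ (l : ℕ → ℝ) (ls : ℝ),
      (∀ k, P.lagrangian f X φ ρ (x k) (z k) (w k) = (l k : EReal)) ∧
      P.lagrangian f X φ ρ xs zs ws = (ls : EReal) ∧
      ∃ c₄ : ℝ, 1 < c₄ ∧ (fun k => l k - ls) =O[atTop] (fun k : ℕ => (c₄ ^ k)⁻¹) := by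
  subst hws
  have hρ0 : 0 < ρ := lt_of_lt_of_le (by positivity) hρ
  have hfeas := hADMM.feasible hx0
  have hxs : ∀ i, xs i ∈ X i := fun i =>
    (hXclosed i).mem_of_tendsto (((PiLp.continuous_apply 2 _ i).tendsto xs).comp hx)
      (Eventually.of_forall fun k => hfeas k i)
  have hAx : Tendsto (fun k => P.A (x k)) atTop (𝓝 (P.A xs)) :=
    ((P.contDiff_A (n := 0)).continuous.tendsto xs).comp hx
  -- The multiplier increments tend to `0`, and they equal `ρ` times the constraint residual.
  have hA : P.A xs + zs = 0 := by
    have h1 := (tendsto_add_atTop_iff_nat 1).2 ((hAx.add hz).const_smul ρ)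
    have h2 := ((tendsto_add_atTop_iff_nat 1).2 hw).sub hw
    have h3 := tendsto_nhds_unique (h2.congr fun k => by
      rw [hADMM.w_step k, add_sub_cancel_left]) h1
    rw [sub_zero] at h3
    exact (smul_eq_zero.1 h3.symm).resolve_left hρ0.ne'
  refine ⟨fun k => Locomotion.smoothLagrangian f φ P.A ρ (x k) (z k) (w k), f xs + φ zs,
    fun k => P.lagrangian_of_feasible f X φ ρ (hfeas k) _ _, ?_, ?_⟩
  · rw [P.lagrangian_of_feasible f X φ ρ hxs]
    simp [Locomotion.smoothLagrangian, hA]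
  obtain ⟨C, hC, hgap⟩ := hADMM.gap_le hx0 hf hμf hfconv hφ hμφ hφconv hLφ hφsmooth hρ0.le hXconv
    hxs hx hz hw hA
  have hdec := hADMM.decrease hx0 hf hμf hfconv hφ hμφ hφconv hLφ hφsmooth hρ hXconv hx hz hw hA
  refine exists_isBigO_inv_pow_of_decrease
    (D := fun k => ‖x (k + 1) - x k‖ ^ 2 + ‖z (k + 1) - z k‖ ^ 2) (a := min (μf / 4) (μφ / 4))
    (by positivity) hC ?_ (fun k => by positivity) ?_ hgap
  · have h1 := (((hf.continuous.tendsto xs).comp hx).add ((hφ.continuous.tendsto zs).comp hz)).add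
      (hw.inner (hAx.add hz) (𝕜 := ℝ)) |>.add ((((hAx.add hz).norm).pow 2).const_mul (ρ / 2))
      |>.sub_const (f xs + φ zs)
    simpa [hA, Locomotion.smoothLagrangian] using h1
  · filter_upwards [hdec] with k hk
    have h1 : min (μf / 4) (μφ / 4) * ‖x (k + 1) - x k‖ ^ 2 ≤ μf / 4 * ‖x (k + 1) - x k‖ ^ 2 := by
      gcongr
      exact min_le_left _ _
    have h2 : min (μf / 4) (μφ / 4) * ‖z (k + 1) - z k‖ ^ 2 ≤ μφ / 4 * ‖z (k + 1) - z k‖ ^ 2 := by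
      gcongr
      exact min_le_right _ _
    linarith
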